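/- Consider a stochastic bandit with $K$ arms, horizon $n$ and standard Gaussian noise: in each round $t=1,\dots,n$ the learner chooses an arm $I_t\in\{1,\dots,K\}$, possibly at random, on the basis of the previously chosen arms and observed rewards, and receives the reward $\mu_{I_t}+\eta_t$, where the $\eta_t\sim\mathcal N(0,1)$ are independent. The mean vector $\mu\in\mathbb R^K$ is unknown and satisfies $\sup_{i,j}(\mu_i-\mu_j)\le 1$. For a strategy $\pi$ and an arm $i$ let $$R^\pi_i=\sup_{\mu}\Big(n\mu_i-\mathbb E^\pi_\mu\sum_{t=1}^n\mu_{I_t}\Big)$$ be the worst-case expected pseudo-regret with respect to arm $i$, the supremum being over all such $\mu$. Let $$\mathcal B=\Big\{B\in[0,n]^K:\ B_i\ge\min\Big\{n,\ \sum_{j\ne i}\frac n{B_j}\Big\}\text{ for all }i\Big\},$$ where $n/0=\infty$ for $n>0$. Theorem. For all $n$ and $K$ and every strategy $\pi$, the vector with entries $\min\{n,\,8(R^\pi_i+K)\}$, $i=1,\dots,K$, belongs to $\mathcal B$. Moreover, if some arm has worst-case regret $B$, another arm has worst-case regret $\Omega(nK/B)$, up to the trivial cap $n$: there is a universal constant $c>0$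 such that for all $n$, all $K\ge 2$, every strategy $\pi$ and every arm $i$, where for $K=2$ we require in addition $R^\pi_i\le n/8$, there is an arm $j\ne i$ with $$R^\pi_j\ge c\,n\qquad\text{or}\qquad R^\pi_i\,R^\pi_j\ge c\,nK .$$ -/

import Mathlib

open MeasureTheory ProbabilityTheory
open scoped ENNReal

/-- A history of `t` rounds of a bandit with `K` arms: in each round, the chosen arm and the
reward that was observed for it. -/
abbrev BanditHistory (K t : ℕ) : Type := Fin t → Fin K × ℝ

/-- A (possibly randomised) bandit strategy with `K` arms: after each history of `t` rounds, a
probability distribution on the arms, depending measurably on the history. A deterministic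
strategy is one for which all these distributions are point masses. -/
structure BanditStrategy (K : ℕ) where
  /-- The conditional law of the next arm given the first `t` rounds. -/
  policy : (t : ℕ) → Kernel (BanditHistory K t) (Fin K)
  /-- The conditional laws are probability measures. -/
  isMarkov : ∀ t, IsMarkovKernel (policy t)

namespace BanditStrategy

instance {K : ℕ} (π : BanditStrategy K) (t : ℕ) : IsMarkovKernel (π.policy t) := π.isMarkov t

end BanditStrategy

/-- The reward of arm `a` in the bandit with mean vector `μ` is `μ a` plus standard Gaussian
noise. -/
noncomputable def gaussianReward {K : ℕ} (μ : Fin K → ℝ) : Kernel (Fin K) ℝ where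
  toFun a := gaussianReal (μ a) 1
  measurable' := measurable_of_finite _

instance {K : ℕ} (μ : Fin K → ℝ) : IsMarkovKernel (gaussianReward μ) where
  isProbabilityMeasure a := inferInstanceAs (IsProbabilityMeasure (gaussianReal (μ a) 1))

/-- One round of interaction: given a history, the arm is drawn from the strategy, and then,
given the history and the arm, the reward is drawn from the distribution of that arm. -/
noncomputable def banditStep {K : ℕ} (π : BanditStrategy K) (μ : Fin K → ℝ) (t : ℕ) :
    Kernel (BanditHistory K t) (Fin K × ℝ) :=
  π.policy t ⊗ₖ Kernel.prodMkLeft (BanditHistory K t) (gaussianReward μ)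

instance {K : ℕ} (π : BanditStrategy K) (μ : Fin K → ℝ) (t : ℕ) :
    IsMarkovKernel (banditStep π μ t) := by
  unfold banditStep; infer_instance

/-- Append one round to a history. -/
def appendRound {K t : ℕ} (p : BanditHistory K t × (Fin K × ℝ)) : BanditHistory K (t + 1) :=
  Fin.snoc (α := fun _ => Fin K × ℝ) p.1 p.2

theorem measurable_appendRound {K t : ℕ} :
    Measurable (appendRound : BanditHistory K t × (Fin K × ℝ) → BanditHistory K (t + 1)) := by
  refine measurable_pi_iff.2 fun s => ?_
  induction s using Fin.lastCases with
  | last => simpa [appendRound] using measurable_snd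
  | cast s => simpa [appendRound, Function.comp_def] using (measurable_pi_apply s).comp measurable_fst

/-- The law of the history of the first `t` rounds when the strategy `π` interacts with the
Gaussian bandit with mean vector `μ`. -/
noncomputable def banditLaw {K : ℕ} (π : BanditStrategy K) (μ : Fin K → ℝ) :
    (t : ℕ) → Measure (BanditHistory K t)
  | 0 => Measure.dirac Fin.elim0
  | t + 1 => (banditLaw π μ t ⊗ₘ banditStep π μ t).map appendRound

instance banditLaw_isProbabilityMeasure {K : ℕ} (π : BanditStrategy K) (μ : Fin K → ℝ) (t : ℕ) :
    IsProbabilityMeasure (banditLaw π μ t) := by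
  induction t with
  | zero => unfold banditLaw; infer_instance
  | succ t ih =>
    unfold banditLaw
    exact Measure.isProbabilityMeasure_map measurable_appendRound.aemeasurable

/-- The `n`-step expected pseudo-regret of `π` with respect to arm `i` in the Gaussian bandit with
mean vector `μ`, namely `n μ_i - 𝔼 ∑_t μ_{I_t}`. -/
noncomputable def pseudoRegret {K : ℕ} (n : ℕ) (π : BanditStrategy K) (μ : Fin K → ℝ)
    (i : Fin K) : ℝ :=
  n * μ i - ∫ h, ∑ t : Fin n, μ (h t).1 ∂(banditLaw π μ n)

/-- The admissible mean vectors: any two means differ by at most `1`. -/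
def admissibleMeans (K : ℕ) : Set (Fin K → ℝ) := {μ | ∀ i j, μ i - μ j ≤ 1}

/-- The worst-case `n`-step expected pseudo-regret of `π` with respect to arm `i`, the supremum of
the pseudo-regret over all admissible mean vectors. -/
noncomputable def worstCaseRegret {K : ℕ} (n : ℕ) (π : BanditStrategy K) (i : Fin K) : ℝ :=
  ⨆ μ : admissibleMeans K, pseudoRegret n π μ i

/-- The set of all `B ∈ [0, n]^K` with `B_i ≥ min {n, ∑_{j ≠ i} n / B_j}` for all `i`. The
inequality is one between extended nonnegative reals, so that `n / 0 = ∞` for `n > 0`. -/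
def regretFrontierSet (n K : ℕ) : Set (Fin K → ℝ) :=
  {B | (∀ i, 0 ≤ B i ∧ B i ≤ n) ∧
    ∀ i, min (n : ℝ≥0∞) (∑ j ∈ Finset.univ.erase i, (n : ℝ≥0∞) / ENNReal.ofReal (B j))
      ≤ ENNReal.ofReal (B i)}

/-! A strategy with small regret against an arm `i` cannot sample slightly worse arms often, so it
cannot notice when one of them is in fact the best. Put arm `i` at mean `0` and every other arm `j`
at `-ε j`; then `∑ ε j * τ j ≤ R i`, with `τ` the expected pull counts. Raising one arm `k` to mean
`e` costs a divergence `(e + ε k) ^ 2 / 2 * τ k`. If this and `τ k / n` are small, arm `k` is still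
missed in a constant fraction of the rounds, so `R k` is at least of order `e * n`. `exists_pulls`
collects these constraints for a single base environment.

For the frontier, `ε j` is taken proportional to `(R j + K) / n`, so that `R j` is too small for arm
`j` to be missed. This forces `ε j * τ j` to be at least of order `n / (R j + K)`, and summing over
`j` bounds `R i` below. The argument is run at the arm of least regret and extended by the
monotonicity of `x + n / x`.

For the product bound, all gaps equal one `e` of order `K / R i`, and the least pulled arm other
than `i` is raised. When `R i` is too large for this, a minimax lower bound for some other arm
suffices; with two arms, the roles are exchanged instead. -/

/-! ### Change of measure along the history -/

theorem lintegral_banditLaw_succ {K : ℕ} (π : BanditStrategy K) (μ : Fin K → ℝ) (t : ℕ)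
    {f : BanditHistory K (t + 1) → ℝ≥0∞} (hf : Measurable f) :
    ∫⁻ h, f h ∂banditLaw π μ (t + 1) =
      ∫⁻ h, ∫⁻ p, f (appendRound (h, p)) ∂banditStep π μ t h ∂banditLaw π μ t := by
  rw [banditLaw, lintegral_map hf measurable_appendRound,
    Measure.lintegral_compProd (f := fun q => f (appendRound q)) (hf.comp measurable_appendRound)]

theorem lintegral_banditStep {K : ℕ} (π : BanditStrategy K) (μ : Fin K → ℝ) (t : ℕ)
    (h : BanditHistory K t) {f : Fin K × ℝ → ℝ≥0∞} (hf : Measurable f) :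
    ∫⁻ p, f p ∂banditStep π μ t h =
      ∫⁻ a, ∫⁻ x, f (a, x) ∂gaussianReal (μ a) 1 ∂π.policy t h := by
  rw [banditStep, Kernel.lintegral_compProd _ _ _ hf]
  rfl

/-- Shifting the mean of a unit-variance Gaussian by `d` multiplies it by an exponential density. -/
theorem lintegral_gaussianReal_add (m d : ℝ) {f : ℝ → ℝ≥0∞} (hf : Measurable f) :
    ∫⁻ x, f x ∂gaussianReal (m + d) 1 =
      ∫⁻ x, f x * ENNReal.ofReal (Real.exp (d * (x - m) - d ^ 2 / 2)) ∂gaussianReal m 1 := by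
  have hm : Measurable fun x : ℝ => f x * ENNReal.ofReal (Real.exp (d * (x - m) - d ^ 2 / 2)) := by
    fun_prop
  rw [gaussianReal_of_var_ne_zero _ one_ne_zero, gaussianReal_of_var_ne_zero _ one_ne_zero,
    lintegral_withDensity_eq_lintegral_mul _ (measurable_gaussianPDF _ _) hf,
    lintegral_withDensity_eq_lintegral_mul _ (measurable_gaussianPDF _ _) hm]
  refine lintegral_congr fun x => ?_
  have hpdf : gaussianPDF (m + d) 1 x =
      gaussianPDF m 1 x * ENNReal.ofReal (Real.exp (d * (x - m) - d ^ 2 / 2)) := by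
    rw [gaussianPDF, gaussianPDF, ← ENNReal.ofReal_mul (gaussianPDFReal_nonneg _ _ _),
      gaussianPDFReal, gaussianPDFReal,
      mul_assoc (√(2 * Real.pi * ((1 : NNReal) : ℝ)))⁻¹, ← Real.exp_add]
    congr 3
    simp only [NNReal.coe_one]
    ring
  simp only [Pi.mul_apply, hpdf]
  ring

/-- The log-likelihood ratio, for one round, of raising the mean of arm `k` by `d`. -/
noncomputable def roundLogLikelihood {K : ℕ} (μ : Fin K → ℝ) (k : Fin K) (d : ℝ)
    (p : Fin K × ℝ) : ℝ :=
  if p.1 = k then d * (p.2 - μ k) - d ^ 2 / 2 else 0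

theorem measurable_roundLogLikelihood {K : ℕ} (μ : Fin K → ℝ) (k : Fin K) (d : ℝ) :
    Measurable (roundLogLikelihood μ k d) := by
  unfold roundLogLikelihood
  refine Measurable.ite (measurable_fst (measurableSet_singleton k)) (by fun_prop) (by fun_prop)

/-- The log-likelihood ratio of a history for raising the mean of arm `k` by `d`. -/
noncomputable def logLikelihood {K : ℕ} (μ : Fin K → ℝ) (k : Fin K) (d : ℝ) {t : ℕ}
    (h : BanditHistory K t) : ℝ :=
  ∑ s, roundLogLikelihood μ k d (h s)

theorem measurable_logLikelihood {K : ℕ} (μ : Fin K → ℝ) (k : Fin K) (d : ℝ) (t : ℕ) :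
    Measurable (logLikelihood μ k d : BanditHistory K t → ℝ) :=
  Finset.measurable_sum _ fun s _ =>
    (measurable_roundLogLikelihood μ k d).comp (measurable_pi_apply s)

theorem logLikelihood_appendRound {K : ℕ} (μ : Fin K → ℝ) (k : Fin K) (d : ℝ) {t : ℕ}
    (h : BanditHistory K t) (p : Fin K × ℝ) :
    logLikelihood μ k d (appendRound (h, p)) =
      logLikelihood μ k d h + roundLogLikelihood μ k d p := by
  simp [logLikelihood, appendRound, Fin.sum_univ_castSucc]

theorem measurable_appendRound_right {K t : ℕ} (h : BanditHistory K t) :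
    Measurable fun p : Fin K × ℝ => appendRound (h, p) :=
  measurable_appendRound.comp measurable_prodMk_left

theorem lintegral_banditStep_update {K : ℕ} (π : BanditStrategy K) (μ : Fin K → ℝ) (k : Fin K)
    (d : ℝ) (t : ℕ) (h : BanditHistory K t) {f : Fin K × ℝ → ℝ≥0∞} (hf : Measurable f) :
    ∫⁻ p, f p ∂banditStep π (Function.update μ k (μ k + d)) t h =
      ∫⁻ p, f p * ENNReal.ofReal (Real.exp (roundLogLikelihood μ k d p)) ∂banditStep π μ t h := by
  have hm := measurable_roundLogLikelihood μ k d
  rw [lintegral_banditStep _ _ _ _ hf, lintegral_banditStep _ _ _ _ (by fun_prop)]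
  refine lintegral_congr fun a => ?_
  by_cases ha : a = k
  · subst ha
    simp only [Function.update_self, roundLogLikelihood, if_true]
    exact lintegral_gaussianReal_add _ _ (hf.comp measurable_prodMk_left)
  · simp [roundLogLikelihood, ha]

/-- Change of measure for the law of the history when the mean of one arm is shifted. -/
theorem lintegral_banditLaw_update {K : ℕ} (π : BanditStrategy K) (μ : Fin K → ℝ) (k : Fin K)
    (d : ℝ) (t : ℕ) {f : BanditHistory K t → ℝ≥0∞} (hf : Measurable f) :
    ∫⁻ h, f h ∂banditLaw π (Function.update μ k (μ k + d)) t =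
      ∫⁻ h, f h * ENNReal.ofReal (Real.exp (logLikelihood μ k d h)) ∂banditLaw π μ t := by
  induction t with
  | zero => simp [banditLaw, logLikelihood]
  | succ t ih =>
    have hr := measurable_roundLogLikelihood μ k d
    have hl := measurable_logLikelihood μ k d (t + 1)
    have hg : Measurable fun q : BanditHistory K t × (Fin K × ℝ) =>
        f (appendRound q) * ENNReal.ofReal (Real.exp (roundLogLikelihood μ k d q.2)) :=
      (hf.comp measurable_appendRound).mul (by fun_prop)
    rw [lintegral_banditLaw_succ _ _ _ hf, lintegral_banditLaw_succ _ _ _ (by fun_prop)]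
    have hstep : ∀ h, ∫⁻ p, f (appendRound (h, p))
          ∂banditStep π (Function.update μ k (μ k + d)) t h =
        ∫⁻ p, f (appendRound (h, p)) * ENNReal.ofReal (Real.exp (roundLogLikelihood μ k d p))
          ∂banditStep π μ t h := fun h =>
      lintegral_banditStep_update π μ k d t h (hf.comp (measurable_appendRound_right h))
    rw [lintegral_congr hstep, ih (Measurable.lintegral_kernel_prod_right' hg)]
    refine lintegral_congr fun h => ?_
    rw [← lintegral_mul_const' _ _ ENNReal.ofReal_ne_top]
    refine lintegral_congr fun p => ?_
    rw [logLikelihood_appendRound, Real.exp_add, ENNReal.ofReal_mul (Real.exp_nonneg _)]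
    ring

/-! ### Pull counts and the divergence decomposition -/

/-- The number of rounds in which arm `k` was chosen. -/
noncomputable def pullCount {K t : ℕ} (k : Fin K) (h : BanditHistory K t) : ℝ :=
  ∑ s, if (h s).1 = k then 1 else 0

theorem measurable_pullCount {K : ℕ} (k : Fin K) (t : ℕ) :
    Measurable (pullCount k : BanditHistory K t → ℝ) :=
  Finset.measurable_sum _ fun s _ => Measurable.ite
    ((measurable_pi_apply s).fst (measurableSet_singleton k)) measurable_const measurable_const

theorem pullCount_nonneg {K t : ℕ} (k : Fin K) (h : BanditHistory K t) : 0 ≤ pullCount k h :=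
  Finset.sum_nonneg fun s _ => by split_ifs <;> norm_num

theorem pullCount_le {K t : ℕ} (k : Fin K) (h : BanditHistory K t) : pullCount k h ≤ t := by
  calc pullCount k h ≤ ∑ _s : Fin t, (1 : ℝ) :=
        Finset.sum_le_sum fun s _ => by split_ifs <;> norm_num
    _ = t := by simp

theorem pullCount_appendRound {K t : ℕ} (k : Fin K) (h : BanditHistory K t) (p : Fin K × ℝ) :
    pullCount k (appendRound (h, p)) = pullCount k h + if p.1 = k then 1 else 0 := by
  simp [pullCount, appendRound, Fin.sum_univ_castSucc]

theorem exp_sub_one_sub_nonneg (s : ℝ) : 0 ≤ Real.exp s - 1 - s := by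
  linarith [Real.add_one_le_exp s]

theorem integrable_exp_gaussianReal (m d c : ℝ) :
    Integrable (fun x => Real.exp (d * x + c)) (gaussianReal m 1) := by
  simp_rw [Real.exp_add]
  exact (integrable_exp_mul_gaussianReal d).mul_const _

/-- One step of the divergence recursion, with `s` the log-likelihood accumulated so far: the
likelihood ratio has mean one and its logarithm has mean `-d ^ 2 / 2`. Using `exp L - 1 - L` instead
of `-L` leaves the expectation unchanged but makes the integrand nonnegative, so that lower
integrals suffice. -/
theorem lintegral_divergence_gaussianReal (m d s : ℝ) :
    ∫⁻ x, ENNReal.ofReal (Real.exp (s + (d * (x - m) - d ^ 2 / 2)) - 1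
        - (s + (d * (x - m) - d ^ 2 / 2))) ∂gaussianReal m 1 =
      ENNReal.ofReal (Real.exp s - 1 - s) + ENNReal.ofReal (d ^ 2 / 2) := by
  have hid : Integrable (fun x : ℝ => x) (gaussianReal m 1) :=
    (memLp_id_gaussianReal (μ := m) (v := 1) 1).integrable le_rfl
  have hexp := integrable_exp_gaussianReal m d (s - d * m - d ^ 2 / 2)
  have hval : ∫ x, Real.exp (d * x + (s - d * m - d ^ 2 / 2)) ∂gaussianReal m 1 = Real.exp s := by
    have h := congrFun (mgf_id_gaussianReal (μ := m) (v := 1)) d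
    simp only [mgf, id] at h
    simp_rw [Real.exp_add _ (s - d * m - d ^ 2 / 2)]
    rw [integral_mul_const, h, ← Real.exp_add]
    congr 1
    simp only [NNReal.coe_one]
    ring
  have hfun : ∀ x : ℝ, Real.exp (s + (d * (x - m) - d ^ 2 / 2)) - 1
      - (s + (d * (x - m) - d ^ 2 / 2)) =
      Real.exp (d * x + (s - d * m - d ^ 2 / 2)) - (d * x + (1 + s - d * m - d ^ 2 / 2)) := by
    intro x
    rw [show s + (d * (x - m) - d ^ 2 / 2) = d * x + (s - d * m - d ^ 2 / 2) by ring]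
    ring
  have hlin : Integrable (fun x : ℝ => d * x + (1 + s - d * m - d ^ 2 / 2)) (gaussianReal m 1) :=
    (hid.const_mul d).add (integrable_const _)
  rw [← ENNReal.ofReal_add (exp_sub_one_sub_nonneg s) (by positivity),
    ← ofReal_integral_eq_lintegral_ofReal _ (ae_of_all _ fun x => exp_sub_one_sub_nonneg _)]
  · congr 1
    simp_rw [hfun]
    rw [integral_sub hexp hlin, integral_add (hid.const_mul d) (integrable_const _),
      integral_const_mul, integral_id_gaussianReal, hval]
    simp
    ring
  · simp_rw [hfun]
    exact hexp.sub hlin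

theorem lintegral_divergence_banditStep {K : ℕ} (π : BanditStrategy K) (μ : Fin K → ℝ)
    (k : Fin K) (d : ℝ) (t : ℕ) (h : BanditHistory K t) (s : ℝ) :
    ∫⁻ p, ENNReal.ofReal (Real.exp (s + roundLogLikelihood μ k d p) - 1
        - (s + roundLogLikelihood μ k d p)) ∂banditStep π μ t h =
      ENNReal.ofReal (Real.exp s - 1 - s) + ENNReal.ofReal (d ^ 2 / 2) *
        ∫⁻ p, ENNReal.ofReal (if p.1 = k then 1 else 0) ∂banditStep π μ t h := by
  have hm := measurable_roundLogLikelihood μ k d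
  have hi : Measurable fun p : Fin K × ℝ => ENNReal.ofReal (if p.1 = k then 1 else 0) :=
    (Measurable.ite (measurable_fst (measurableSet_singleton k))
      measurable_const measurable_const).ennreal_ofReal
  rw [lintegral_banditStep _ _ _ _ (by fun_prop), lintegral_banditStep _ _ _ _ hi,
    ← lintegral_const_mul _ (measurable_of_finite _)]
  have hconst : ENNReal.ofReal (Real.exp s - 1 - s) =
      ∫⁻ _a, ENNReal.ofReal (Real.exp s - 1 - s) ∂π.policy t h := by simp
  rw [hconst, ← lintegral_add_left measurable_const]
  refine lintegral_congr fun a => ?_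
  by_cases ha : a = k
  · subst ha
    simp only [roundLogLikelihood, if_true]
    rw [lintegral_divergence_gaussianReal]
    simp
  · simp [roundLogLikelihood, ha]

/-- The divergence between the two laws is governed by the expected number of pulls of the arm
whose mean is shifted. -/
theorem lintegral_divergence_banditLaw {K : ℕ} (π : BanditStrategy K) (μ : Fin K → ℝ)
    (k : Fin K) (d : ℝ) (t : ℕ) :
    ∫⁻ h, ENNReal.ofReal (Real.exp (logLikelihood μ k d h) - 1 - logLikelihood μ k d h)
        ∂banditLaw π μ t =
      ENNReal.ofReal (d ^ 2 / 2) * ∫⁻ h, ENNReal.ofReal (pullCount k h) ∂banditLaw π μ t := by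
  induction t with
  | zero => simp [banditLaw, logLikelihood, pullCount]
  | succ t ih =>
    have hl := measurable_logLikelihood μ k d (t + 1)
    have hl' := measurable_logLikelihood μ k d t
    have hp := measurable_pullCount (K := K) k (t + 1)
    have hp' := measurable_pullCount (K := K) k t
    rw [lintegral_banditLaw_succ _ _ _ (by fun_prop), lintegral_banditLaw_succ _ _ _ (by fun_prop)]
    simp_rw [logLikelihood_appendRound, pullCount_appendRound, lintegral_divergence_banditStep]
    rw [lintegral_add_left (by fun_prop), ih, ← lintegral_const_mul' _ _ ENNReal.ofReal_ne_top,
      ← lintegral_add_left (by fun_prop), ← lintegral_const_mul' _ _ ENNReal.ofReal_ne_top]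
    refine lintegral_congr fun h => ?_
    rw [← mul_add]
    congr 1
    have hnn : ∀ p : Fin K × ℝ, ENNReal.ofReal (pullCount k h + if p.1 = k then 1 else 0) =
        ENNReal.ofReal (pullCount k h) + ENNReal.ofReal (if p.1 = k then 1 else 0) := fun p =>
      ENNReal.ofReal_add (pullCount_nonneg k h) (by split_ifs <;> norm_num)
    simp_rw [hnn]
    rw [lintegral_add_left measurable_const]
    simp

/-! ### Expected pulls, regret and transport between environments -/

/-- The expected number of pulls of arm `k` in `n` rounds. -/
noncomputable def expectedPulls {K : ℕ} (n : ℕ) (π : BanditStrategy K) (μ : Fin K → ℝ)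
    (k : Fin K) : ℝ :=
  ∫ h, pullCount k h ∂banditLaw π μ n

theorem integrable_pullCount {K : ℕ} (n : ℕ) (π : BanditStrategy K) (μ : Fin K → ℝ)
    (k : Fin K) : Integrable (pullCount k) (banditLaw π μ n) :=
  Integrable.of_bound (measurable_pullCount k n).aestronglyMeasurable n
    (ae_of_all _ fun h => by
      rw [Real.norm_eq_abs, abs_of_nonneg (pullCount_nonneg k h)]; exact pullCount_le k h)

theorem expectedPulls_nonneg {K : ℕ} (n : ℕ) (π : BanditStrategy K) (μ : Fin K → ℝ)
    (k : Fin K) : 0 ≤ expectedPulls n π μ k :=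
  integral_nonneg fun h => pullCount_nonneg k h

theorem sum_mul_pullCount {K n : ℕ} (μ : Fin K → ℝ) (h : BanditHistory K n) :
    ∑ k, μ k * pullCount k h = ∑ t, μ (h t).1 := by
  simp_rw [pullCount, Finset.mul_sum]
  rw [Finset.sum_comm]
  simp

theorem sum_mul_expectedPulls {K : ℕ} (n : ℕ) (π : BanditStrategy K) (μ w : Fin K → ℝ) :
    ∑ k, w k * expectedPulls n π μ k = ∫ h, ∑ t : Fin n, w (h t).1 ∂banditLaw π μ n := by
  simp_rw [← sum_mul_pullCount, expectedPulls]
  rw [integral_finsetSum _ fun k _ => (integrable_pullCount n π μ k).const_mul _]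
  simp_rw [integral_const_mul]

theorem sum_expectedPulls {K : ℕ} (n : ℕ) (π : BanditStrategy K) (μ : Fin K → ℝ) :
    ∑ k, expectedPulls n π μ k = n := by
  simpa using sum_mul_expectedPulls n π μ 1

theorem pseudoRegret_eq_sum {K : ℕ} (n : ℕ) (π : BanditStrategy K) (μ : Fin K → ℝ) (i : Fin K) :
    pseudoRegret n π μ i = ∑ k, (μ i - μ k) * expectedPulls n π μ k := by
  simp_rw [sub_mul, Finset.sum_sub_distrib, ← Finset.mul_sum, sum_expectedPulls,
    sum_mul_expectedPulls, pseudoRegret]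
  ring

/-- A linear substitute for Pinsker's inequality: after integration, total variation is at most `1 /
4` plus twice the divergence. It amounts to `2 * s + 11 / 4 ≤ 3 * exp s`, which is the tangent bound
at `-3 / 8`, near the point `log (2 / 3)` where `3 * exp s` has slope `2`. -/
theorem one_sub_exp_le (s : ℝ) : 1 - Real.exp s ≤ 1 / 4 + 2 * (Real.exp s - 1 - s) := by
  have h1 : 2 / 3 ≤ Real.exp (-(3 / 8)) := by
    have h := Real.add_one_le_exp (-(3 / 32) : ℝ)
    calc (2 / 3 : ℝ) ≤ (-(3 / 32) + 1) ^ 4 := by norm_num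
      _ ≤ Real.exp (-(3 / 32)) ^ 4 := by gcongr
      _ = Real.exp (-(3 / 8)) := by rw [← Real.exp_nat_mul]; congr 1; norm_num
  have h2 := Real.add_one_le_exp (s + 3 / 8)
  have h3 : Real.exp s = Real.exp (s + 3 / 8) * Real.exp (-(3 / 8)) := by
    rw [← Real.exp_add]; ring_nf
  have h4 : Real.exp (s + 3 / 8) * (2 / 3) ≤ Real.exp s := by
    rw [h3]; exact mul_le_mul_of_nonneg_left h1 (Real.exp_nonneg _)
  linarith

theorem le_mul_exp_add (T N s : ℝ) (hT : 0 ≤ T) (hTN : T ≤ N) :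
    T ≤ T * Real.exp s + N * (1 / 4 + 2 * (Real.exp s - 1 - s)) := by
  have hφ := exp_sub_one_sub_nonneg s
  rcases le_total 0 s with hs | hs
  · have h1 : 1 ≤ Real.exp s := Real.one_le_exp hs
    have : 0 ≤ N * (1 / 4 + 2 * (Real.exp s - 1 - s)) := mul_nonneg (hT.trans hTN) (by linarith)
    nlinarith
  · have hx1 : Real.exp s ≤ 1 := Real.exp_le_one_iff.2 hs
    have hx0 := Real.exp_pos s
    have h3 := one_sub_exp_le s
    nlinarith

/-- Raising the mean of arm `k` by `d` increases its expected number of pulls by a controlled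
amount. -/
theorem expectedPulls_update_le {K : ℕ} (n : ℕ) (π : BanditStrategy K) (μ : Fin K → ℝ)
    (k : Fin K) (d : ℝ) :
    expectedPulls n π (Function.update μ k (μ k + d)) k ≤
      expectedPulls n π μ k + n * (1 / 4 + d ^ 2 * expectedPulls n π μ k) := by
  set ν := Function.update μ k (μ k + d)
  have hl := measurable_logLikelihood μ k d n
  have hp := measurable_pullCount (K := K) k n
  have hτ : ∀ ρ : Fin K → ℝ, ∫⁻ h, ENNReal.ofReal (pullCount k h) ∂banditLaw π ρ n =
      ENNReal.ofReal (expectedPulls n π ρ k) := fun ρ =>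
    (ofReal_integral_eq_lintegral_ofReal (integrable_pullCount n π ρ k)
      (ae_of_all _ fun h => pullCount_nonneg k h)).symm
  have hσ : ∀ ρ : Fin K → ℝ, ∫⁻ h, ENNReal.ofReal (n - pullCount k h) ∂banditLaw π ρ n =
      ENNReal.ofReal (n - expectedPulls n π ρ k) := fun ρ => by
    rw [← ofReal_integral_eq_lintegral_ofReal (f := fun h => (n : ℝ) - pullCount k h)
      ((integrable_const _).sub (integrable_pullCount n π ρ k))
      (ae_of_all _ fun h => sub_nonneg.2 (pullCount_le k h)),
      integral_sub (integrable_const _) (integrable_pullCount n π ρ k)]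
    simp [expectedPulls]
  have hle : ∀ ρ : Fin K → ℝ, 0 ≤ n - expectedPulls n π ρ k := fun ρ => by
    rw [← sum_expectedPulls n π ρ]
    exact sub_nonneg.2 (Finset.single_le_sum
      (fun j _ => expectedPulls_nonneg n π ρ j) (Finset.mem_univ k))
  have hτ0 := expectedPulls_nonneg n π μ k
  -- The pointwise bound is applied to the rounds not spent on `k`, which bounds the pulls of `k`
  -- under `ν` from above. The factor `2` cancels the `1 / 2` in the divergence.
  have main : ENNReal.ofReal (n - expectedPulls n π μ k) ≤
      ENNReal.ofReal ((n - expectedPulls n π ν k)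
        + n * (1 / 4 + d ^ 2 * expectedPulls n π μ k)) := by
    calc ENNReal.ofReal (n - expectedPulls n π μ k)
        = ∫⁻ h, ENNReal.ofReal (n - pullCount k h) ∂banditLaw π μ n := (hσ μ).symm
      _ ≤ ∫⁻ h, (ENNReal.ofReal (n - pullCount k h)
              * ENNReal.ofReal (Real.exp (logLikelihood μ k d h))
            + ENNReal.ofReal n * (ENNReal.ofReal (1 / 4) + ENNReal.ofReal 2 *
              ENNReal.ofReal (Real.exp (logLikelihood μ k d h) - 1 - logLikelihood μ k d h)))
            ∂banditLaw π μ n := by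
          refine lintegral_mono fun h => ?_
          have h0 := sub_nonneg.2 (pullCount_le k h)
          have hφ := exp_sub_one_sub_nonneg (logLikelihood μ k d h)
          rw [← ENNReal.ofReal_mul h0, ← ENNReal.ofReal_mul (by norm_num),
            ← ENNReal.ofReal_add (by norm_num) (by positivity),
            ← ENNReal.ofReal_mul (by positivity),
            ← ENNReal.ofReal_add (mul_nonneg h0 (Real.exp_nonneg _)) (by positivity)]
          exact ENNReal.ofReal_le_ofReal (le_mul_exp_add _ _ _ h0
            (by linarith [pullCount_nonneg k h]))
      _ = ENNReal.ofReal (n - expectedPulls n π ν k) + ENNReal.ofReal n *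
            (ENNReal.ofReal (1 / 4) + ENNReal.ofReal 2 *
              (ENNReal.ofReal (d ^ 2 / 2) * ENNReal.ofReal (expectedPulls n π μ k))) := by
          rw [lintegral_add_left (by fun_prop), ← lintegral_banditLaw_update _ _ _ _ _
            (by fun_prop), hσ, lintegral_const_mul _ (by fun_prop),
            lintegral_add_left measurable_const, lintegral_const_mul _ (by fun_prop),
            lintegral_divergence_banditLaw, hτ]
          simp [ν]
      _ = _ := by
          rw [← ENNReal.ofReal_mul (by positivity), ← ENNReal.ofReal_mul (by norm_num),
            ← ENNReal.ofReal_add (by norm_num) (by positivity),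
            ← ENNReal.ofReal_mul (by positivity), ← ENNReal.ofReal_add (hle ν) (by positivity)]
          congr 4
          ring
  have := (ENNReal.ofReal_le_ofReal_iff (add_nonneg (hle ν) (by positivity))).1 main
  linarith

/-! ### Constraints imposed by worst-case regret -/

theorem pseudoRegret_le {K : ℕ} (n : ℕ) (π : BanditStrategy K) {μ : Fin K → ℝ}
    (hμ : μ ∈ admissibleMeans K) (i : Fin K) : pseudoRegret n π μ i ≤ n := by
  rw [pseudoRegret_eq_sum, ← sum_expectedPulls n π μ]
  exact Finset.sum_le_sum fun k _ =>
    mul_le_of_le_one_left (expectedPulls_nonneg n π μ k) (hμ i k)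

theorem pseudoRegret_le_worstCaseRegret {K : ℕ} (n : ℕ) (π : BanditStrategy K) {μ : Fin K → ℝ}
    (hμ : μ ∈ admissibleMeans K) (i : Fin K) :
    pseudoRegret n π μ i ≤ worstCaseRegret n π i :=
  le_ciSup (f := fun μ : admissibleMeans K => pseudoRegret n π μ i)
    ⟨n, by rintro _ ⟨μ, rfl⟩; exact pseudoRegret_le n π μ.2 i⟩ ⟨μ, hμ⟩

theorem zero_mem_admissibleMeans (K : ℕ) : (0 : Fin K → ℝ) ∈ admissibleMeans K := by
  intro i j; simp

theorem worstCaseRegret_nonneg {K : ℕ} (n : ℕ) (π : BanditStrategy K) (i : Fin K) :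
    0 ≤ worstCaseRegret n π i := by
  refine le_trans ?_ (pseudoRegret_le_worstCaseRegret n π (zero_mem_admissibleMeans K) i)
  simp [pseudoRegret]

/-- Against the means `-ε`, with `ε i = 0`, the expected numbers of pulls are constrained by the
worst-case regrets with respect to all arms. -/
theorem exists_pulls {K : ℕ} (n : ℕ) (π : BanditStrategy K) (i : Fin K) (ε : Fin K → ℝ)
    (hi : ε i = 0) (h0 : ∀ j, 0 ≤ ε j) (h1 : ∀ j, ε j ≤ 1 / 2) :
    ∃ τ : Fin K → ℝ, (∀ j, 0 ≤ τ j) ∧ ∑ j, τ j = n ∧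
      ∑ j, ε j * τ j ≤ worstCaseRegret n π i ∧
      ∀ k (e : ℝ), 0 ≤ e → e ≤ 1 / 2 →
        e * (3 / 4 * n - τ k - n * ((e + ε k) ^ 2 * τ k)) ≤ worstCaseRegret n π k := by
  refine ⟨expectedPulls n π (-ε), expectedPulls_nonneg n π _, sum_expectedPulls n π _, ?_, ?_⟩
  · have hadm : -ε ∈ admissibleMeans K := fun a b => by
      simp only [Pi.neg_apply]; linarith [h0 a, h1 b]
    refine le_trans (le_of_eq ?_) (pseudoRegret_le_worstCaseRegret n π hadm i)
    rw [pseudoRegret_eq_sum]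
    simp [hi]
  · intro k e he0 he1
    -- This shift moves arm `k` from `-ε k` to exactly `e`, while every other mean stays at most
    -- `0`; each round spent elsewhere then costs at least `e`.
    have hup := expectedPulls_update_le n π (-ε) k (e + ε k)
    set ν := Function.update (-ε) k ((-ε) k + (e + ε k)) with hν
    have hνk : ν k = e := by simp [hν]
    have hνj : ∀ j, j ≠ k → ν j = -ε j := fun j hj => by simp [hν, hj]
    have hle : ∀ j, -(1 / 2) ≤ ν j ∧ ν j ≤ 1 / 2 := fun j => by
      by_cases hj : j = k
      · subst hj; rw [hνk]; constructor <;> linarith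
      · rw [hνj j hj]; constructor <;> linarith [h0 j, h1 j]
    have hadm : ν ∈ admissibleMeans K := fun a b => by linarith [(hle a).2, (hle b).1]
    have hreg := pseudoRegret_le_worstCaseRegret n π hadm k
    have hsum : e * (n - expectedPulls n π ν k) ≤ pseudoRegret n π ν k := by
      rw [pseudoRegret_eq_sum, ← sum_expectedPulls n π ν,
        ← Finset.sum_erase_eq_sub (Finset.mem_univ k), Finset.mul_sum,
        ← Finset.sum_erase (a := k) Finset.univ
          (f := fun j => (ν k - ν j) * expectedPulls n π ν j) (by simp)]
      refine Finset.sum_le_sum fun j hj => ?_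
      refine mul_le_mul_of_nonneg_right ?_ (expectedPulls_nonneg n π ν j)
      rw [hνk, hνj j (Finset.ne_of_mem_erase hj)]
      linarith [h0 j]
    have := mul_le_mul_of_nonneg_left hup he0
    nlinarith

/-! ### Membership in the frontier set -/

/-- The frontier inequality for an arm with the smallest worst-case regret. -/
theorem sum_div_le_of_forall_le {K : ℕ} (n : ℕ) (π : BanditStrategy K) (i : Fin K)
    (hmin : ∀ j, worstCaseRegret n π i ≤ worstCaseRegret n π j)
    (hi : 8 * (worstCaseRegret n π i + K) < n) :
    ∑ j ∈ Finset.univ.erase i, (n : ℝ) / min (n : ℝ) (8 * (worstCaseRegret n π j + K)) ≤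
      8 * (worstCaseRegret n π i + K) := by
  set R := worstCaseRegret n π with hR
  have hR0 : ∀ j, 0 ≤ R j := worstCaseRegret_nonneg n π
  have hK : (1 : ℝ) ≤ K := by exact_mod_cast i.pos
  have hn : (0 : ℝ) < n := by linarith [hR0 i]
  -- The gap is chosen so that `ε j * n / 4 = R j + K` just exceeds `R j`. Arms at the cap `n` get
  -- no gap: each contributes only `1` to the sum, which the added `K` absorbs.
  set ε : Fin K → ℝ := fun j =>
    if j ≠ i ∧ 8 * (R j + K) < n then 4 * (R j + K) / n else 0 with hε
  have hε0 : ∀ j, 0 ≤ ε j := fun j => by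
    have := hR0 j
    simp only [hε]; split_ifs <;> positivity
  have hε1 : ∀ j, ε j ≤ 1 / 2 := fun j => by
    simp only [hε]
    split_ifs with h
    · rw [div_le_iff₀ hn]; linarith [h.2]
    · norm_num
  obtain ⟨τ, hτ0, -, hτi, hτ⟩ := exists_pulls n π i ε (by simp [hε]) hε0 hε1
  have hterm : ∀ j, 0 ≤ ε j * τ j := fun j => mul_nonneg (hε0 j) (hτ0 j)
  have hj : ∀ j ∈ Finset.univ.erase i,
      (n : ℝ) / min (n : ℝ) (8 * (R j + K)) ≤ 8 * (ε j * τ j) + 1 := by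
    intro j hj
    by_cases hjA : 8 * (R j + K) < n
    · have hεj : ε j = 4 * (R j + K) / n := by
        simp only [hε]; rw [if_pos ⟨Finset.ne_of_mem_erase hj, hjA⟩]
      have hr : 0 < R j + K := by linarith [hR0 j]
      have hεr : ε j * n = 4 * (R j + K) := by rw [hεj]; field_simp
      have hεpos : 0 < ε j := by rw [hεj]; positivity
      have hlow := hτ j (ε j) hεpos.le (hε1 j)
      have hsingle : ε j * τ j ≤ R i :=
        (Finset.single_le_sum (fun j _ => hterm j) (Finset.mem_univ j)).trans hτi
      -- Minimality of `R i` enters here: `ε j * τ j ≤ R i ≤ R j < ε j * n / 4`.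
      have hlt : τ j < n / 4 := by
        by_contra hcon
        have : ε j * (n / 4) ≤ ε j * τ j := mul_le_mul_of_nonneg_left (not_lt.1 hcon) hεpos.le
        linarith [hmin j]
      -- Otherwise raising arm `j` to `ε j` would leave it missed in more than `n / 4` rounds, at a
      -- regret above `R j`.
      have hquad : 1 / 16 ≤ ε j ^ 2 * τ j := by
        by_contra hcon
        rw [not_le] at hcon
        have h4 : n * ((ε j + ε j) ^ 2 * τ j) ≤ n * (1 / 4) :=
          mul_le_mul_of_nonneg_left (by nlinarith) hn.le
        have : ε j * (n / 4) < ε j * (3 / 4 * n - τ j - n * ((ε j + ε j) ^ 2 * τ j)) :=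
          mul_lt_mul_of_pos_left (by linarith) hεpos
        linarith
      rw [min_eq_right hjA.le]
      have hmain : (n : ℝ) / (8 * (R j + K)) ≤ 8 * (ε j * τ j) := by
        rw [div_le_iff₀ (by positivity)]
        have : (n : ℝ) * (1 / 16) ≤ n * (ε j ^ 2 * τ j) :=
          mul_le_mul_of_nonneg_left hquad hn.le
        have h5 : n * (ε j ^ 2 * τ j) = 4 * (R j + K) * (ε j * τ j) := by rw [← hεr]; ring
        linarith
      linarith
    · rw [min_eq_left (not_lt.1 hjA), div_self hn.ne']
      linarith [hterm j]
  calc ∑ j ∈ Finset.univ.erase i, (n : ℝ) / min (n : ℝ) (8 * (R j + K))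
      ≤ ∑ j ∈ Finset.univ.erase i, (8 * (ε j * τ j) + 1) := Finset.sum_le_sum hj
    _ ≤ ∑ j, (8 * (ε j * τ j) + 1) :=
        Finset.sum_le_sum_of_subset_of_nonneg (Finset.erase_subset _ _)
          fun j _ _ => by linarith [hterm j]
    _ = 8 * ∑ j, ε j * τ j + K := by
        rw [Finset.sum_add_distrib, ← Finset.mul_sum]; simp
    _ ≤ 8 * (R i + K) := by linarith

/-- If the frontier inequality holds at the smallest coordinate, it holds at all of them. -/
theorem sum_div_le_of_min {ι : Type*} [Fintype ι] [DecidableEq ι] {n : ℝ} (hn : 0 < n)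
    {B : ι → ℝ} (hB : ∀ j, 0 < B j) {m : ι} (hm : ∀ j, B m ≤ B j)
    (h : ∑ j ∈ Finset.univ.erase m, n / B j ≤ B m) (i : ι) :
    ∑ j ∈ Finset.univ.erase i, n / B j ≤ B i := by
  by_cases him : i = m
  · rwa [him]
  rw [Finset.sum_erase_eq_sub (Finset.mem_univ _)] at h ⊢
  have hi := hB i
  have hmp := hB m
  have hpos : ∀ j, 0 ≤ n / B j := fun j => (div_pos hn (hB j)).le
  have hsingle : n / B i ≤ ∑ j, n / B j - n / B m := by
    rw [← Finset.sum_erase_eq_sub (Finset.mem_univ m)]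
    exact Finset.single_le_sum (fun j _ => hpos j)
      (Finset.mem_erase.2 ⟨him, Finset.mem_univ i⟩)
  -- The claim compares `x + n / x` at `B m ≤ B i`. It is larger at `B i` because the product of the
  -- two points is at least `n`, as one term of the sum in `h` already shows.
  have hprod : n ≤ B m * B i := (div_le_iff₀ hi).1 (hsingle.trans h)
  have hdiff : n / B m - n / B i ≤ B i - B m := by
    have : n / B m - n / B i = n / (B m * B i) * (B i - B m) := by field_simp
    rw [this]
    exact mul_le_of_le_one_left (sub_nonneg.2 (hm i)) ((div_le_one (by positivity)).2 hprod)
  linarith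

theorem mem_regretFrontierSet {K : ℕ} (n : ℕ) (π : BanditStrategy K) :
    (fun i : Fin K => min (n : ℝ) (8 * (worstCaseRegret n π i + K))) ∈ regretFrontierSet n K := by
  set R := worstCaseRegret n π with hR
  have hR0 : ∀ j, 0 ≤ R j := worstCaseRegret_nonneg n π
  refine ⟨fun i => ⟨le_min (by positivity) (by have := hR0 i; positivity), min_le_left _ _⟩,
    fun i => ?_⟩
  have hK : (1 : ℝ) ≤ K := by exact_mod_cast i.pos
  rcases Nat.eq_zero_or_pos n with rfl | hn
  · simp
  have hn' : (0 : ℝ) < n := by exact_mod_cast hn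
  have : Nonempty (Fin K) := ⟨i⟩
  set B : Fin K → ℝ := fun i => min (n : ℝ) (8 * (R i + K)) with hBdef
  have hB : ∀ j, 0 < B j := fun j => lt_min hn' (by linarith [hR0 j])
  obtain ⟨m, hm⟩ := Finite.exists_min R
  by_cases hmn : 8 * (R m + K) < n
  · refine (min_le_right _ _).trans ?_
    have hsum : ∑ j ∈ Finset.univ.erase m, (n : ℝ) / B j ≤ B m := by
      have := sum_div_le_of_forall_le n π m hm hmn
      rwa [← hR, ← min_eq_right hmn.le] at this
    have hBm : ∀ j, B m ≤ B j := fun j => min_le_min le_rfl (by linarith [hm j])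
    have hfin := sum_div_le_of_min hn' hB hBm hsum i
    calc ∑ j ∈ Finset.univ.erase i, (n : ℝ≥0∞) / ENNReal.ofReal (B j)
        = ∑ j ∈ Finset.univ.erase i, ENNReal.ofReal (n / B j) := by
          refine Finset.sum_congr rfl fun j _ => ?_
          rw [ENNReal.ofReal_div_of_pos (hB j), ENNReal.ofReal_natCast]
      _ = ENNReal.ofReal (∑ j ∈ Finset.univ.erase i, n / B j) :=
          (ENNReal.ofReal_sum_of_nonneg fun j _ => (div_pos hn' (hB j)).le).symm
      _ ≤ ENNReal.ofReal (B i) := ENNReal.ofReal_le_ofReal hfin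
  · have hBi : B i = n := min_eq_left (by linarith [hm i])
    rw [hBi, ENNReal.ofReal_natCast]
    exact min_le_left _ _

/-! ### Trade-off between two arms -/

theorem exists_ne_mul_le_of_sum_le {K : ℕ} (i : Fin K) (hK : 2 ≤ K) {τ : Fin K → ℝ} {S : ℝ}
    (h : ∑ j ∈ Finset.univ.erase i, τ j ≤ S) : ∃ j, j ≠ i ∧ ((K : ℝ) - 1) * τ j ≤ S := by
  have hcard : (Finset.univ.erase i).card = K - 1 := by simp
  have hne : (Finset.univ.erase i).Nonempty := by rw [← Finset.card_pos, hcard]; omega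
  obtain ⟨j, hj, hmin⟩ := Finset.exists_min_image _ τ hne
  refine ⟨j, Finset.ne_of_mem_erase hj, le_trans ?_ h⟩
  have := Finset.card_nsmul_le_sum _ _ _ hmin
  rw [hcard, nsmul_eq_mul, Nat.cast_sub (by omega)] at this
  simpa using this

/-- An arm of moderate worst-case regret forces some other arm to have large regret. -/
theorem exists_regret_tradeoff {K : ℕ} (n : ℕ) (hn : 1 ≤ n) (π : BanditStrategy K) (i : Fin K)
    (hK : 2 ≤ K) (h1 : worstCaseRegret n π i ≤ n * (K - 1) / 8)
    (h2 : worstCaseRegret n π i ^ 2 ≤ n * (K - 1) ^ 2 / 256) :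
    ∃ j, j ≠ i ∧ (7 / 32 * n ≤ worstCaseRegret n π j ∨
      7 / 1024 * (n * (K - 1)) ≤ worstCaseRegret n π i * worstCaseRegret n π j) := by
  set R := worstCaseRegret n π with hR
  have hR0 : 0 ≤ R i := worstCaseRegret_nonneg n π i
  have hn' : (1 : ℝ) ≤ n := by exact_mod_cast hn
  have hK' : (1 : ℝ) ≤ (K : ℝ) - 1 := by
    have : (2 : ℝ) ≤ K := by exact_mod_cast hK
    linarith
  set κ : ℝ := (K : ℝ) - 1
  -- With all gaps equal to `e`, some `τ j` is at most `R i / (e * κ)`. The two conditions on `R i`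
  -- give `e ^ 2 * τ j ≤ 1 / 64` and `τ j ≤ n / 4`, and `3/4 - 1/4 - 1/16 = 7/16`.
  have core : ∀ e : ℝ, 0 < e → e ≤ 1 / 2 → e * R i ≤ κ / 64 → R i ≤ n / 4 * (e * κ) →
      ∃ j, j ≠ i ∧ 7 / 16 * (e * n) ≤ R j := by
    intro e he0 he1 ha hb
    obtain ⟨τ, hτ0, -, hτi, hτ⟩ := exists_pulls n π i (fun j => if j = i then 0 else e)
      (by simp) (fun j => by split_ifs <;> linarith)
      (fun j => by split_ifs <;> linarith)
    have hsum : ∑ j ∈ Finset.univ.erase i, e * τ j ≤ R i := by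
      refine le_trans (le_of_eq ?_) hτi
      rw [← Finset.sum_erase (a := i) Finset.univ (f := fun j => (if j = i then 0 else e) * τ j)
        (by simp)]
      refine Finset.sum_congr rfl fun j hj => ?_
      rw [if_neg (Finset.ne_of_mem_erase hj)]
    obtain ⟨j, hji, hj⟩ := exists_ne_mul_le_of_sum_le i hK hsum
    refine ⟨j, hji, le_trans ?_ (hτ j e he0.le he1)⟩
    rw [if_neg hji]
    have hτj := hτ0 j
    have hτ4 : τ j ≤ n / 4 := by
      have : (e * κ) * τ j ≤ (e * κ) * (n / 4) := by
        change κ * (e * τ j) ≤ R i at hj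
        linarith
      exact le_of_mul_le_mul_left this (by positivity)
    have hq : e ^ 2 * τ j ≤ 1 / 64 := by
      have : κ * (e ^ 2 * τ j) ≤ κ * (1 / 64) := by
        have := mul_le_mul_of_nonneg_left hj he0.le
        change e * (κ * (e * τ j)) ≤ e * R i at this
        linarith
      exact le_of_mul_le_mul_left this (by positivity)
    have hq' : n * ((e + e) ^ 2 * τ j) ≤ n * (1 / 16) :=
      mul_le_mul_of_nonneg_left (by linarith) (by linarith)
    have : e * (7 / 16 * n) ≤ e * (3 / 4 * n - τ j - n * ((e + e) ^ 2 * τ j)) :=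
      mul_le_mul_of_nonneg_left (by linarith) he0.le
    linarith
  -- The largest gap that `core` allows is `κ / (64 * R i)`, capped at `1 / 2`; the cap is active
  -- exactly when `R i ≤ κ / 32`.
  by_cases hsmall : R i ≤ κ / 32
  · obtain ⟨j, hji, hj⟩ := core (1 / 2) (by norm_num) le_rfl (by linarith) (by linarith)
    exact ⟨j, hji, Or.inl (by linarith)⟩
  · have hRpos : 0 < R i := by linarith
    have he : κ / (64 * R i) * R i = κ / 64 := by field_simp
    obtain ⟨j, hji, hj⟩ := core (κ / (64 * R i)) (by positivity)
      (by rw [div_le_iff₀ (by positivity)]; linarith) he.le (by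
        rw [show (n : ℝ) / 4 * (κ / (64 * R i) * κ) = (n * κ ^ 2 / 256) / R i by
            field_simp; norm_num,
          le_div_iff₀ hRpos]
        linarith)
    refine ⟨j, hji, Or.inr ?_⟩
    have := mul_le_mul_of_nonneg_left hj hR0
    have h3 : R i * (7 / 16 * (κ / (64 * R i) * n)) = 7 / 16 * n * (κ / (64 * R i) * R i) := by ring
    rw [h3, he] at this
    linarith

/-- With at least three arms, some arm other than `i` has the minimax regret. -/
theorem exists_minimax_regret {K : ℕ} (n : ℕ) (hn : 1 ≤ n) (π : BanditStrategy K) (i : Fin K)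
    (hK : 3 ≤ K) :
    ∃ j, j ≠ i ∧ (1 / 16 * (n : ℝ) ≤ worstCaseRegret n π j ∨
      1 / 512 * (n * ((K : ℝ) - 1)) ≤ worstCaseRegret n π j ^ 2) := by
  set R := worstCaseRegret n π with hR
  have hn' : (1 : ℝ) ≤ n := by exact_mod_cast hn
  have hK' : (2 : ℝ) ≤ (K : ℝ) - 1 := by
    have : (3 : ℝ) ≤ K := by exact_mod_cast hK
    linarith
  set κ : ℝ := (K : ℝ) - 1
  obtain ⟨τ, hτ0, hτn, -, hτ⟩ := exists_pulls n π i 0 rfl (by simp) (by intro j; norm_num)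
  obtain ⟨j, hji, hj⟩ := exists_ne_mul_le_of_sum_le i (by omega : 2 ≤ K)
    ((Finset.sum_le_sum_of_subset_of_nonneg (Finset.erase_subset i Finset.univ)
      fun j _ _ => hτ0 j).trans hτn.le)
  change κ * τ j ≤ n at hj
  have hτj := hτ0 j
  -- Three arms are needed here: with two, the only other arm could take all the pulls.
  have hτ2 : τ j ≤ n / 2 := by nlinarith
  have core : ∀ e : ℝ, 0 ≤ e → e ≤ 1 / 2 → 8 * n * e ^ 2 ≤ κ → e * (n / 8) ≤ R j := by
    intro e he0 he1 he
    refine le_trans ?_ (hτ j e he0 he1)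
    refine mul_le_mul_of_nonneg_left ?_ he0
    have hq : e ^ 2 * τ j ≤ 1 / 8 := by
      have h1 : 8 * n * (e ^ 2 * τ j) ≤ 8 * n * (1 / 8) := by
        nlinarith [mul_le_mul_of_nonneg_right he hτj]
      exact le_of_mul_le_mul_left h1 (by linarith)
    have : n * ((e + (0 : Fin K → ℝ) j) ^ 2 * τ j) ≤ n * (1 / 8) := by
      simpa using mul_le_mul_of_nonneg_left hq (by linarith : (0 : ℝ) ≤ n)
    linarith
  refine ⟨j, hji, ?_⟩
  by_cases hsmall : 2 * n ≤ κ
  · left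
    have := core (1 / 2) (by norm_num) le_rfl (by linarith)
    linarith
  · right
    have hs : √(κ / (8 * n)) ^ 2 = κ / (8 * n) := Real.sq_sqrt (by positivity)
    have := core √(κ / (8 * n)) (Real.sqrt_nonneg _)
      (by
        rw [Real.sqrt_le_left (by norm_num), div_le_iff₀ (by positivity)]
        linarith)
      (by rw [hs]; exact le_of_eq (by field_simp))
    have h2 := pow_le_pow_left₀ (by positivity) this 2
    rw [mul_pow, hs] at h2
    refine le_trans (le_of_eq ?_) h2
    field_simp
    norm_num

theorem exists_tradeoff_of_three_le {K : ℕ} (n : ℕ) (hn : 1 ≤ n) (π : BanditStrategy K)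
    (i : Fin K) (hK : 3 ≤ K) :
    ∃ j, j ≠ i ∧ (1 / 1024 * n ≤ worstCaseRegret n π j ∨
      1 / 1024 * (n * K) ≤ worstCaseRegret n π i * worstCaseRegret n π j) := by
  set R := worstCaseRegret n π with hR
  have hR0 : ∀ j, 0 ≤ R j := worstCaseRegret_nonneg n π
  have hn' : (1 : ℝ) ≤ n := by exact_mod_cast hn
  have hK' : (3 : ℝ) ≤ K := by exact_mod_cast hK
  have hnκ : (n : ℝ) * K ≤ 2 * (n * ((K : ℝ) - 1)) := by nlinarith
  by_cases h : R i ≤ n * (K - 1) / 8 ∧ R i ^ 2 ≤ n * (K - 1) ^ 2 / 256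
  · obtain ⟨j, hji, hj⟩ := exists_regret_tradeoff n hn π i (by omega) h.1 h.2
    rw [← hR] at hj
    refine ⟨j, hji, hj.imp (fun hj => ?_) fun hj => ?_⟩ <;> nlinarith
  · obtain ⟨j, hji, hj⟩ := exists_minimax_regret n hn π i hK
    refine ⟨j, hji, hj.imp (fun hj => by linarith) fun hj => ?_⟩
    -- Whichever condition fails, `R i` is at least of order `K * √n`; multiplied by a minimax
    -- regret of order `√(n * K)` this exceeds `n * K`.
    have hsq : (n : ℝ) * (K - 1) ^ 2 / 256 ≤ R i ^ 2 := by
      by_cases h1 : R i ≤ n * (K - 1) / 8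
      · exact (lt_of_not_ge fun h2 => h ⟨h1, h2⟩).le
      · have h3 := pow_le_pow_left₀ (by nlinarith) (not_le.1 h1).le 2
        refine le_trans ?_ h3
        have : (n : ℝ) * (K - 1) ^ 2 ≤ n ^ 2 * (K - 1) ^ 2 :=
          mul_le_mul_of_nonneg_right (by nlinarith) (sq_nonneg _)
        nlinarith [sq_nonneg ((n : ℝ) * (K - 1))]
    rw [← hR] at hj
    have hmul := mul_le_mul hsq hj (by nlinarith) (sq_nonneg _)
    have hcube : (n : ℝ) ^ 2 * (K - 1) ^ 2 ≤ n ^ 2 * (K - 1) ^ 3 := by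
      have : (0 : ℝ) ≤ n ^ 2 * (K - 1) ^ 2 := by positivity
      nlinarith
    refine le_of_sq_le_sq ?_ (mul_nonneg (hR0 i) (hR0 j))
    have hsqK := pow_le_pow_left₀ (by positivity) hnκ 2
    nlinarith

theorem exists_tradeoff_of_eq_two {K : ℕ} (n : ℕ) (hn : 1 ≤ n) (π : BanditStrategy K)
    (i : Fin K) (hK : K = 2) (hi : worstCaseRegret n π i ≤ n / 8) :
    ∃ j, j ≠ i ∧ (1 / 1024 * n ≤ worstCaseRegret n π j ∨
      1 / 1024 * (n * K) ≤ worstCaseRegret n π i * worstCaseRegret n π j) := by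
  set R := worstCaseRegret n π with hR
  have hR0 : ∀ j, 0 ≤ R j := worstCaseRegret_nonneg n π
  have hn' : (1 : ℝ) ≤ n := by exact_mod_cast hn
  have hKr : (K : ℝ) = 2 := by exact_mod_cast hK
  by_cases h : R i ^ 2 ≤ n / 256
  · obtain ⟨j, hji, hj⟩ := exists_regret_tradeoff n hn π i (by omega)
      (by rw [hKr, ← hR]; linarith) (by rw [hKr, ← hR]; linarith)
    rw [← hR, hKr] at hj
    refine ⟨j, hji, hj.imp (fun hj => by linarith) fun hj => ?_⟩
    rw [hKr]; linarith
  obtain ⟨j, hji⟩ : ∃ j, j ≠ i := by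
    have : Nontrivial (Fin K) := by rw [hK]; infer_instance
    exact exists_ne i
  refine ⟨j, hji, Or.inr ?_⟩
  have huniq : ∀ l, l ≠ j → l = i := by
    intro l hl
    subst hK
    omega
  rw [hKr]
  rw [not_le] at h
  have hRi := hR0 i
  have hRj := hR0 j
  -- If both regrets are at least `√n / 16`, the product bound is immediate. Otherwise only `R j` is
  -- small, and the trade-off is applied from `j`; its alternative `7 / 32 * n ≤ R i` contradicts `R
  -- i ≤ n / 8`.
  by_cases hij : R i ≤ R j
  · nlinarith
  rw [not_le] at hij
  by_cases hj : R j ^ 2 ≤ n / 256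
  · obtain ⟨l, hlj, hl⟩ := exists_regret_tradeoff n hn π j (by omega)
      (by rw [hKr, ← hR]; linarith) (by rw [hKr, ← hR]; linarith)
    rw [huniq l hlj, ← hR, hKr] at hl
    rcases hl with hl | hl <;> linarith
  · nlinarith

theorem theorem1 :
    (∀ (n K : ℕ) (π : BanditStrategy K),
      (fun i : Fin K => min (n : ℝ) (8 * (worstCaseRegret n π i + K))) ∈ regretFrontierSet n K) ∧
    (∃ c : ℝ, 0 < c ∧ ∀ (n K : ℕ) (π : BanditStrategy K) (i : Fin K), 2 ≤ K →
      (3 ≤ K ∨ worstCaseRegret n π i ≤ n / 8) →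
      ∃ j : Fin K, j ≠ i ∧
        (c * n ≤ worstCaseRegret n π j ∨
          c * (n * K) ≤ worstCaseRegret n π i * worstCaseRegret n π j)) := by
  refine ⟨fun n K π => mem_regretFrontierSet n π, 1 / 1024, by norm_num,
    fun n K π i hK h => ?_⟩
  rcases Nat.eq_zero_or_pos n with rfl | hn
  · have : Nontrivial (Fin K) := Fin.nontrivial_iff_two_le.2 hK
    obtain ⟨j, hj⟩ := exists_ne i
    exact ⟨j, hj, Or.inl (by simpa using worstCaseRegret_nonneg 0 π j)⟩
  by_cases h3 : 3 ≤ K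
  · exact exists_tradeoff_of_three_le n hn π i h3
  · exact exists_tradeoff_of_eq_two n hn π i (by omega) (h.resolve_left h3)
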